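/- Let $d\ge 1$, let $p\in(1,\infty)$, let $q=\frac{p}{p-1}$ be its conjugate exponent, and let $c$ be the real number with $2^{1/c}=p^{1/p}q^{1/q}$. For a finitely supported function $u:\mathbb{Z}^d\to[0,\infty)$ and $r\ge 1$ write $\|u\|_r=\bigl(\sum_{x\in\mathbb{Z}^d}|u(x)|^r\bigr)^{1/r}$, and for two such functions $u,v$ let $(u\,\bar{*}\,v)(z)=\sup_{x\in\mathbb{Z}^d}u(x)v(z-x)$ be their sup-convolution. (i) For all finitely supported $f,g,h:\mathbb{Z}^d\to[0,\infty)$ with $f$ supported on $\{0,1\}^d$, $$\|f\,\bar{*}\,g\,\bar{*}\,h\|_1\ \ge\ \|f\|_c\,\|g\|_p\,\|h\|_q .$$ (ii) In particular, for all finite $A,B\subset\mathbb{Z}^d$ and all $V\subseteq\{0,1\}^d$, $$|V+A+B|\ \ge\ |V|^{1/c}\,|A|^{1/p}\,|B|^{1/q}\ \ge\ \Bigl(\frac{p^{1/p}q^{1/q}}{2}\Bigr)^{d}|V|\,|A|^{1/p}\,|B|^{1/q},$$ so that this strengthens the Matolcsi–Ruzsa–Shakan–Zhelezov lower bound for $|V+A+B|$,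 which is the last expression. -/

import Mathlib

open scoped Pointwise

noncomputable section

/-- The `ℓ^r` norm `(∑_{x ∈ ℤ^d} |f x|^r)^{1/r}` of a function on `ℤ^d`, used for functions
with finite support, for which the series is a finite sum. -/
def ellNorm {d : ℕ} (r : ℝ) (f : (Fin d → ℤ) → ℝ) : ℝ :=
  (∑' x : Fin d → ℤ, |f x| ^ r) ^ (1 / r)

/-- The sup-convolution `z ↦ sup_{x ∈ ℤ^d} f(x) g(z - x)`. For finitely supported `f` and `g`
the set of values is finite, so the supremum is attained. -/
def supConv {d : ℕ} (f g : (Fin d → ℤ) → ℝ) : (Fin d → ℤ) → ℝ :=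
  fun z => ⨆ x : Fin d → ℤ, f x * g (z - x)

/-- The discrete cube `{0,1}^d ⊆ ℤ^d`. -/
def discreteCube (d : ℕ) : Set (Fin d → ℤ) :=
  {x | ∀ i, x i = 0 ∨ x i = 1}

end

/-!
The inequality tensorizes: summing over the fibres of `E × E'` turns the norms of the slices of `f`,
`g`, `h` into functions on `E` to which the inequality on `E` applies (`SupConvIneq.prod`). So
everything reduces to `ℤ`, with `f` supported on `{0, 1}`; by homogeneity and reflection `f` takes
the values `1` and `b ≤ 1`, and `g` and `h` have maximum `1`.

For `0 < b < 1`, extend `g` to `ℝ` by `u x = b ^ fract x * g ⌊x⌋`, and `h` to `v` likewise. With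
`K` the function dominating the products on `ℤ` and `k w = b ^ fract w * K ⌊w⌋`, the two inequalities
coming from the two points of `{0, 1}` say exactly that `u x * v y ≤ k (x + y)` on `ℝ`
(`tsum_mul_lintegral_add_le`). The one-dimensional Brunn–Minkowski inequality, applied to the level
sets of `u ^ p`, `v ^ q` and `k`, gives `∫ u ^ p + ∫ v ^ q ≤ ∫ k`. Evaluating the integrals over unit
intervals and using the weighted arithmetic-geometric mean inequality leads to
`(1 - b ^ p) ^ (1 / p) * (1 - b ^ q) ^ (1 / q) * ‖g‖_p * ‖h‖_q ≤ (1 - b) * ‖K‖₁`.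

It remains to compare constants, `(1 - b) (1 + b ^ c) ^ (1 / c) ≤ (1 - b ^ p) ^ (1 / p)
(1 - b ^ q) ^ (1 / q)` (`one_sub_mul_rpow_le`). With `b = exp (-2 s)`, the difference of the
logarithms tends to `0` at both ends of `(0, ∞)`, so it is enough that its derivative changes sign at
most once, from `+` to `-`. That derivative is, up to a positive factor, a combination of five
functions `cosh (ρ s)`, and a version of Descartes' rule of signs for such sums counts its sign
changes (`oneCrossing_five_cosh`).

The statement about sets is the case of indicator functions, together with `|V| ≤ 2 ^ d`, `1 ≤ c`.
-/

open Filter Topology MeasureTheory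
open scoped ENNReal

/-! ### Sign changes of sums of hyperbolic cosines -/

/-- A function on `(0, ∞)` which, once negative, never becomes positive again. -/
def OneCrossing (f : ℝ → ℝ) : Prop :=
  ∀ x y, 0 < x → x < y → f x < 0 → f y ≤ 0

theorem OneCrossing.of_mul_pos {f m : ℝ → ℝ} (hm : ∀ x, 0 < x → 0 < m x)
    (h : OneCrossing fun x => f x * m x) : OneCrossing f := by
  intro x y hx hxy hf
  have := h x y hx hxy (mul_neg_of_neg_of_pos hf (hm x hx))
  exact nonpos_of_mul_nonpos_left this (hm y (hx.trans hxy))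

theorem OneCrossing.mul_pos {f m : ℝ → ℝ} (hm : ∀ x, 0 < x → 0 < m x)
    (h : OneCrossing f) : OneCrossing fun x => f x * m x := by
  intro x y hx hxy hf
  have := h x y hx hxy (by
    by_contra! h0
    exact absurd hf (not_lt.2 (mul_nonneg h0 (hm x hx).le)))
  exact mul_nonpos_of_nonpos_of_nonneg this (hm y (hx.trans hxy)).le

/-- The mean value theorem transfers the sign pattern from a derivative to a function vanishing
at `0`. -/
theorem OneCrossing.of_deriv {F g : ℝ → ℝ} (h0 : F 0 = 0) (hF : ∀ x, HasDerivAt F (g x) x)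
    (hg : OneCrossing g) : OneCrossing F := by
  intro x y hx hxy hFx
  by_contra! hFy
  have hc : Continuous F := continuous_iff_continuousAt.2 fun z => (hF z).continuousAt
  obtain ⟨u, hu, hu'⟩ := exists_hasDerivAt_eq_slope F g hx hc.continuousOn fun z _ => hF z
  obtain ⟨v, hv, hv'⟩ := exists_hasDerivAt_eq_slope F g hxy hc.continuousOn fun z _ => hF z
  have h1 : g u < 0 := by
    rw [hu', h0]; exact div_neg_of_neg_of_pos (by linarith) (by linarith)
  have h2 : 0 < g v := by
    rw [hv']; exact div_pos (by linarith) (by linarith)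
  exact absurd (hg u v hu.1 (hu.2.trans hv.1) h1) (not_le.2 h2)

/-- Since `f'' - r² f = (cosh² (f / cosh)')' / cosh` with `cosh = cosh (r ·)`, two applications of
`OneCrossing.of_deriv` pass from `f'' - r² f` to `f`. -/
theorem OneCrossing.of_deriv_two {f f' f'' : ℝ → ℝ} (r : ℝ) (h0 : f 0 = 0) (h0' : f' 0 = 0)
    (hf : ∀ x, HasDerivAt f (f' x) x) (hf' : ∀ x, HasDerivAt f' (f'' x) x)
    (h : OneCrossing fun x => f'' x - r ^ 2 * f x) : OneCrossing f := by
  have hlin : ∀ x : ℝ, HasDerivAt (fun x : ℝ => r * x) r x := fun x => by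
    simpa using (hasDerivAt_id x).const_mul r
  have hch : ∀ x : ℝ, HasDerivAt (fun x => Real.cosh (r * x)) (Real.sinh (r * x) * r) x :=
    fun x => (hlin x).cosh
  have hsh : ∀ x : ℝ, HasDerivAt (fun x => Real.sinh (r * x)) (Real.cosh (r * x) * r) x :=
    fun x => (hlin x).sinh
  have hw : OneCrossing fun x => f' x * Real.cosh (r * x) - f x * (r * Real.sinh (r * x)) := by
    refine OneCrossing.of_deriv (g := fun x => (f'' x - r ^ 2 * f x) * Real.cosh (r * x))
      (by simp [h0, h0']) (fun x => ?_) (h.mul_pos fun x _ => Real.cosh_pos _)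
    refine (((hf' x).mul (hch x)).sub ((hf x).mul ((hsh x).const_mul r))).congr_deriv ?_
    ring
  -- `f' cosh - f cosh'` has the sign pattern, and it is `cosh²` times the derivative of `f / cosh`
  refine OneCrossing.of_mul_pos (m := fun x => (Real.cosh (r * x))⁻¹)
    (fun x _ => inv_pos.2 (Real.cosh_pos _)) ?_
  refine OneCrossing.of_deriv (g := fun x => (f' x * Real.cosh (r * x) -
    f x * (r * Real.sinh (r * x))) * (Real.cosh (r * x) ^ 2)⁻¹) (by simp [h0]) (fun x => ?_)
    (hw.mul_pos fun x _ => inv_pos.2 (pow_pos (Real.cosh_pos _) 2))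
  have hne := (Real.cosh_pos (r * x)).ne'
  refine ((hf x).mul ((hch x).inv hne)).congr_deriv ?_
  simp only [Pi.inv_apply]
  field_simp
  ring

/-- One step of Descartes' rule of signs: applying `f ↦ f'' - r² f` multiplies the coefficient of
`cosh (ρ ·)` by `ρ² - r²`, and removes the frequency `r`. -/
theorem OneCrossing.cosh_sum {ι : Type*} [Fintype ι] (a ρ : ι → ℝ) (r : ℝ) (h0 : ∑ i, a i = 0)
    (h : OneCrossing fun x => ∑ i, a i * (ρ i ^ 2 - r ^ 2) * Real.cosh (ρ i * x)) :
    OneCrossing fun x => ∑ i, a i * Real.cosh (ρ i * x) := by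
  have hlin : ∀ (i : ι) (x : ℝ), HasDerivAt (fun x : ℝ => ρ i * x) (ρ i) x := fun i x => by
    simpa using (hasDerivAt_id x).const_mul (ρ i)
  refine OneCrossing.of_deriv_two (f' := fun x => ∑ i, a i * (Real.sinh (ρ i * x) * ρ i))
    (f'' := fun x => ∑ i, a i * (Real.cosh (ρ i * x) * ρ i * ρ i)) r (by simpa using h0)
    (by simp) (fun x => ?_) (fun x => ?_) ?_
  · exact HasDerivAt.fun_sum fun i _ => ((hlin i x).cosh.const_mul (a i))
  · exact HasDerivAt.fun_sum fun i _ => (((hlin i x).sinh.mul_const (ρ i)).const_mul (a i))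
  · convert h using 2 with x
    rw [Finset.mul_sum, ← Finset.sum_sub_distrib]
    exact Finset.sum_congr rfl fun i _ => by ring

theorem cosh_mul_cosh_le {r R x y : ℝ} (hr : |r| ≤ R) (hx : 0 < x) (hxy : x < y) :
    Real.cosh (r * y) * Real.cosh (R * x) ≤ Real.cosh (r * x) * Real.cosh (R * y) := by
  have h1 : Real.cosh (r * y + R * x) + Real.cosh (r * y - R * x) ≤
      Real.cosh (r * x - R * y) + Real.cosh (r * x + R * y) := by
    obtain ⟨h1, h2⟩ := abs_le.1 hr
    have e1 : Real.cosh (r * y + R * x) ≤ Real.cosh (r * x + R * y) := by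
      rw [Real.cosh_le_cosh, abs_le, abs_of_nonneg (by nlinarith)]
      constructor <;> nlinarith
    have e2 : Real.cosh (r * y - R * x) ≤ Real.cosh (r * x - R * y) := by
      rw [Real.cosh_le_cosh, abs_le, abs_of_nonpos (by nlinarith)]
      constructor <;> nlinarith
    linarith
  rw [Real.cosh_add, Real.cosh_sub, Real.cosh_sub, Real.cosh_add] at h1
  linarith

/-- The case in which only the coefficient of the highest frequency is negative: after division by
`cosh (R ·)` the function is antitone. -/
theorem oneCrossing_cosh_three {A B C R r s : ℝ} (hB : 0 ≤ B) (hC : 0 ≤ C)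
    (hr : |r| ≤ R) (hs : |s| ≤ R) :
    OneCrossing fun x => -A * Real.cosh (R * x) + B * Real.cosh (r * x) +
      C * Real.cosh (s * x) := by
  intro x y hx hxy hf
  have h1 := mul_le_mul_of_nonneg_left (cosh_mul_cosh_le hr hx hxy) hB
  have h2 := mul_le_mul_of_nonneg_left (cosh_mul_cosh_le hs hx hxy) hC
  have h3 := mul_neg_of_neg_of_pos hf (Real.cosh_pos (R * y))
  by_contra! h
  have h4 := mul_pos h (Real.cosh_pos (R * x))
  nlinarith

/-- As `p + q = p * q`, the coefficients `aᵢ` and the frequencies `ρᵢ` satisfy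
`∑ aᵢ = ∑ aᵢ ρᵢ ^ 2 = 0`, which is what is needed to remove the frequencies `p - q - c - 1` and
`p + q - 1 - c`. Among the other three only the highest has a negative coefficient. -/
theorem oneCrossing_five_cosh {p q c : ℝ} (hpq : p + q = p * q) (hq : 1 ≤ q) (hqp : q ≤ p)
    (hc : 1 ≤ c) (hcp : c ≤ p) :
    OneCrossing fun s => Real.cosh ((p + q + 1 - c) * s) - Real.cosh ((p + q + c - 1) * s)
      - 2 * Real.cosh ((p + q - 1 - c) * s) + Real.cosh ((p - q + c + 1) * s)
      + Real.cosh ((p - q - c - 1) * s) := by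
  have key := OneCrossing.cosh_sum ![1, -1, -2, 1, 1]
    ![p + q + 1 - c, p + q + c - 1, p + q - 1 - c, p - q + c + 1, p - q - c - 1] (p - q - c - 1)
    (by simp [Fin.sum_univ_succ]; norm_num) (by
      refine OneCrossing.cosh_sum _ _ (p + q - 1 - c) ?_ ?_
      · simp [Fin.sum_univ_succ]
        linear_combination 8 * hpq
      · have := oneCrossing_cosh_three (R := p + q + c - 1) (r := p + q + 1 - c)
          (s := p - q + c + 1)
          (A := ((p + q + c - 1) ^ 2 - (p - q - c - 1) ^ 2) *
            ((p + q + c - 1) ^ 2 - (p + q - 1 - c) ^ 2))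
          (B := ((p + q + 1 - c) ^ 2 - (p - q - c - 1) ^ 2) *
            ((p + q + 1 - c) ^ 2 - (p + q - 1 - c) ^ 2))
          (C := ((p - q + c + 1) ^ 2 - (p - q - c - 1) ^ 2) *
            ((p - q + c + 1) ^ 2 - (p + q - 1 - c) ^ 2))
          (mul_nonneg (by nlinarith) (by nlinarith)) (mul_nonneg (by nlinarith) (by nlinarith))
          (abs_le.2 ⟨by linarith, by linarith⟩) (abs_le.2 ⟨by linarith, by linarith⟩)
        convert this using 2 with x
        simp [Fin.sum_univ_succ]
        ring)
  convert key using 2 with x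
  simp [Fin.sum_univ_succ]
  ring

/-- The product-to-sum formula that clears the denominators in the derivative of
`s ↦ log (sinh (p s)) / p + log (sinh (q s)) / q - log (sinh s) - log (2 cosh (c s)) / c`. -/
theorem coth_combination_eq (p q c s : ℝ) (hp : Real.sinh (p * s) ≠ 0)
    (hq : Real.sinh (q * s) ≠ 0) (hs : Real.sinh s ≠ 0) :
    (Real.cosh (p * s) / Real.sinh (p * s) + Real.cosh (q * s) / Real.sinh (q * s)
      - Real.cosh s / Real.sinh s - Real.sinh (c * s) / Real.cosh (c * s)) *
      (4 * (Real.sinh (p * s) * Real.sinh (q * s) * Real.sinh s * Real.cosh (c * s))) =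
    Real.cosh ((p + q + 1 - c) * s) - Real.cosh ((p + q + c - 1) * s)
      - 2 * Real.cosh ((p + q - 1 - c) * s) + Real.cosh ((p - q + c + 1) * s)
      + Real.cosh ((p - q - c - 1) * s) := by
  have hc := (Real.cosh_pos (c * s)).ne'
  have e1 : (p + q + 1 - c) * s = p * s + q * s + (s - c * s) := by ring
  have e2 : (p + q + c - 1) * s = p * s + q * s - (s - c * s) := by ring
  have e3 : (p + q - 1 - c) * s = p * s + q * s - (s + c * s) := by ring
  have e4 : (p - q + c + 1) * s = p * s - q * s + (s + c * s) := by ring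
  have e5 : (p - q - c - 1) * s = p * s - q * s - (s + c * s) := by ring
  rw [e1, e2, e3, e4, e5]
  simp only [Real.cosh_add, Real.cosh_sub, Real.sinh_add, Real.sinh_sub]
  generalize Real.sinh (p * s) = P at *
  generalize Real.sinh (q * s) = Q at *
  generalize Real.sinh s = S at *
  generalize Real.cosh (c * s) = C at *
  field_simp
  ring

/-! ### Comparison of the constants -/

theorem nonneg_of_oneCrossing_deriv {F g : ℝ → ℝ} (hF : ∀ x, 0 < x → HasDerivAt F (g x) x)
    (h0 : Tendsto F (𝓝[>] 0) (𝓝 0)) (h1 : Tendsto F atTop (𝓝 0)) (hg : OneCrossing g)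
    {x : ℝ} (hx : 0 < x) : 0 ≤ F x := by
  by_contra! hFx
  have mvt : ∀ {u v : ℝ}, 0 < u → u < v → ∃ w ∈ Set.Ioo u v, g w = (F v - F u) / (v - u) := by
    intro u v hu huv
    refine exists_hasDerivAt_eq_slope F g huv ?_ fun z hz => hF z (hu.trans hz.1)
    exact fun z hz => (hF z (hu.trans_le hz.1)).continuousAt.continuousWithinAt
  obtain ⟨u, huF, hu⟩ :=
    ((h0.eventually (lt_mem_nhds hFx)).and (Ioo_mem_nhdsGT hx)).exists
  obtain ⟨w, hw, hgw⟩ := mvt hu.1 hu.2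
  have hgw' : g w < 0 := hgw ▸ div_neg_of_neg_of_pos (by linarith) (by linarith [hu.2])
  refine absurd (le_of_tendsto h1 ?_) (not_le.2 hFx)
  filter_upwards [eventually_gt_atTop x] with y hy
  by_contra! hFy
  obtain ⟨v, hv, hgv⟩ := mvt hx hy
  have hgv' : 0 < g v := hgv ▸ div_pos (by linarith) (by linarith)
  exact absurd (hg w v (hu.1.trans hw.1) (hw.2.trans hv.1) hgw') (not_le.2 hgv')

/-- The right-hand side tends to `0` as `s → 0`, by the choice of `c`, and as `s → ∞`; the sign
pattern of its derivative makes it nonnegative in between. -/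
theorem log_one_sub_exp_nonneg {p q c s : ℝ} (hpq : p.HolderConjugate q) (hqp : q ≤ p)
    (hc : 1 ≤ c) (hcp : c ≤ p)
    (hlog : 1 / c * Real.log 2 = 1 / p * Real.log p + 1 / q * Real.log q) (hs : 0 < s) :
    0 ≤ 1 / p * Real.log (1 - Real.exp (-2 * (p * s))) +
      1 / q * Real.log (1 - Real.exp (-2 * (q * s))) - Real.log (1 - Real.exp (-2 * s)) -
      1 / c * Real.log (1 + Real.exp (-2 * (c * s))) := by
  have hp0 := hpq.pos
  have hq0 := hpq.symm.pos
  have hc0 : 0 < c := by linarith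
  have hinv : 1 / p + 1 / q = 1 := by simpa using hpq.inv_add_inv_eq_one
  set F : ℝ → ℝ := fun s => 1 / p * Real.log (Real.sinh (p * s)) +
    1 / q * Real.log (Real.sinh (q * s)) - Real.log (Real.sinh s) -
      1 / c * Real.log (2 * Real.cosh (c * s)) with hFdef
  have hsinh : ∀ r s : ℝ, 0 < r → 0 < s → 0 < Real.sinh (r * s) := fun r s hr hs =>
    Real.sinh_pos_iff.2 (mul_pos hr hs)
  have hexp1 : ∀ r : ℝ, 0 < r → 0 < 1 - Real.exp (-2 * r) := fun r hr => by
    simpa using hr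
  have logsinh : ∀ r : ℝ, 0 < r →
      Real.log (Real.sinh r) = r + Real.log (1 - Real.exp (-2 * r)) - Real.log 2 := by
    intro r hr
    have : Real.sinh r = Real.exp r * (1 - Real.exp (-2 * r)) / 2 := by
      rw [Real.sinh_eq, mul_sub, ← Real.exp_add]; ring_nf
    rw [this, Real.log_div (mul_ne_zero (Real.exp_pos _).ne' (hexp1 r hr).ne') two_ne_zero,
      Real.log_mul (Real.exp_pos _).ne' (hexp1 r hr).ne', Real.log_exp]
  have logcosh : ∀ r : ℝ,
      Real.log (2 * Real.cosh r) = r + Real.log (1 + Real.exp (-2 * r)) := by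
    intro r
    have : 2 * Real.cosh r = Real.exp r * (1 + Real.exp (-2 * r)) := by
      rw [Real.cosh_eq, mul_add, ← Real.exp_add]; ring_nf
    rw [this, Real.log_mul (Real.exp_pos _).ne' (by positivity), Real.log_exp]
  have hform : ∀ s, 0 < s → F s = 1 / p * Real.log (1 - Real.exp (-2 * (p * s))) +
      1 / q * Real.log (1 - Real.exp (-2 * (q * s))) - Real.log (1 - Real.exp (-2 * s)) -
      1 / c * Real.log (1 + Real.exp (-2 * (c * s))) := by
    intro s hs
    simp only [hFdef]
    rw [logsinh _ (mul_pos hp0 hs), logsinh _ (mul_pos hq0 hs), logsinh _ hs, logcosh]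
    have e1 : 1 / p * (p * s) = s := by field_simp
    have e2 : 1 / q * (q * s) = s := by field_simp
    have e3 : 1 / c * (c * s) = s := by field_simp
    linear_combination e1 + e2 - e3 - Real.log 2 * hinv
  rw [← hform s hs]
  have hexp : ∀ r : ℝ, 0 < r → Tendsto (fun s => Real.exp (-2 * (r * s))) atTop (𝓝 0) := by
    intro r hr
    refine Real.tendsto_exp_atBot.comp ?_
    exact (tendsto_id.const_mul_atTop hr).const_mul_atTop_of_neg (by norm_num)
  refine nonneg_of_oneCrossing_deriv (F := F) (g := fun s =>
    Real.cosh (p * s) / Real.sinh (p * s) + Real.cosh (q * s) / Real.sinh (q * s)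
      - Real.cosh s / Real.sinh s - Real.sinh (c * s) / Real.cosh (c * s)) ?_ ?_ ?_ ?_ hs
  · intro x hx
    have hlin : ∀ r : ℝ, HasDerivAt (fun x : ℝ => r * x) r x := fun r => by
      simpa using (hasDerivAt_id x).const_mul r
    have d1 := ((hlin p).sinh.log (hsinh p x hp0 hx).ne').const_mul (1 / p)
    have d2 := ((hlin q).sinh.log (hsinh q x hq0 hx).ne').const_mul (1 / q)
    have d3 := (Real.hasDerivAt_sinh x).log (Real.sinh_pos_iff.2 hx).ne'
    have d4 := (((hlin c).cosh.const_mul 2).log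
      (mul_pos two_pos (Real.cosh_pos _)).ne').const_mul (1 / c)
    refine (((d1.add d2).sub d3).sub d4).congr_deriv ?_
    field_simp
  · have slope : ∀ r : ℝ, Tendsto (fun s => Real.sinh (r * s) / s) (𝓝[>] 0) (𝓝 r) := by
      intro r
      have hd : HasDerivAt (fun x : ℝ => Real.sinh (r * x)) r 0 := by
        have hlin : HasDerivAt (fun x : ℝ => r * x) r 0 := by
          simpa using (hasDerivAt_id (0 : ℝ)).const_mul r
        simpa using hlin.sinh
      have := (hasDerivAt_iff_tendsto_slope.1 hd).mono_left
        (nhdsWithin_mono 0 (fun x (hx : 0 < x) => hx.ne'))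
      refine this.congr fun x => ?_
      simp [slope_def_field]
    have logslope : ∀ r : ℝ, 0 < r →
        Tendsto (fun s => Real.log (Real.sinh (r * s) / s)) (𝓝[>] 0) (𝓝 (Real.log r)) :=
      fun r hr => (slope r).log hr.ne'
    have hcosh : Tendsto (fun s => Real.log (2 * Real.cosh (c * s))) (𝓝[>] 0)
        (𝓝 (Real.log 2)) := by
      have : Continuous fun s => Real.log (2 * Real.cosh (c * s)) := by
        refine Continuous.log (by fun_prop) fun x => (mul_pos two_pos (Real.cosh_pos _)).ne'
      simpa using (this.tendsto 0).mono_left nhdsWithin_le_nhds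
    have lim := ((((logslope p hp0).const_mul (1 / p)).add
      ((logslope q hq0).const_mul (1 / q))).sub (logslope 1 one_pos)).sub
        (hcosh.const_mul (1 / c))
    rw [hlog, Real.log_one, sub_zero, sub_self] at lim
    refine lim.congr' ?_
    filter_upwards [self_mem_nhdsWithin] with x hx
    have hx : 0 < x := hx
    simp only [hFdef]
    rw [Real.log_div (hsinh p x hp0 hx).ne' hx.ne', Real.log_div (hsinh q x hq0 hx).ne' hx.ne',
      Real.log_div (hsinh 1 x one_pos hx).ne' hx.ne', one_mul]
    linear_combination (-Real.log x) * hinv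
  · have lsub : ∀ r : ℝ, 0 < r →
        Tendsto (fun s => Real.log (1 - Real.exp (-2 * (r * s)))) atTop (𝓝 0) := by
      intro r hr
      have := ((hexp r hr).const_sub 1).log (by norm_num)
      simpa using this
    have ladd : Tendsto (fun s => Real.log (1 + Real.exp (-2 * (c * s)))) atTop (𝓝 0) := by
      have := ((hexp c hc0).const_add 1).log (by norm_num)
      simpa using this
    have lim := ((((lsub p hp0).const_mul (1 / p)).add
      ((lsub q hq0).const_mul (1 / q))).sub (lsub 1 one_pos)).sub (ladd.const_mul (1 / c))
    simp only [mul_zero, add_zero, sub_zero, one_mul] at lim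
    refine lim.congr' ?_
    filter_upwards [eventually_gt_atTop 0] with x hx
    exact (hform x hx).symm
  · refine OneCrossing.of_mul_pos (m := fun s => 4 * (Real.sinh (p * s) * Real.sinh (q * s) *
      Real.sinh s * Real.cosh (c * s))) ?_ ?_
    · intro x hx
      have := hsinh p x hp0 hx
      have := hsinh q x hq0 hx
      have := Real.sinh_pos_iff.2 hx
      have := Real.cosh_pos (c * x)
      positivity
    · have key := oneCrossing_five_cosh (c := c) hpq.mul_eq_add.symm hpq.symm.lt.le hqp hc hcp
      intro x y hx hxy
      have hy := hx.trans hxy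
      simp only
      rw [coth_combination_eq p q c x (hsinh p x hp0 hx).ne' (hsinh q x hq0 hx).ne'
        (Real.sinh_pos_iff.2 hx).ne', coth_combination_eq p q c y (hsinh p y hp0 hy).ne'
        (hsinh q y hq0 hy).ne' (Real.sinh_pos_iff.2 hy).ne']
      exact key x y hx hxy

/-- The logarithmic form of the equation defining `c`. -/
theorem log_two_div_eq {p q c : ℝ} (hpq : p.HolderConjugate q)
    (hc : (2 : ℝ) ^ (1 / c) = p ^ (1 / p) * q ^ (1 / q)) :
    1 / c * Real.log 2 = 1 / p * Real.log p + 1 / q * Real.log q := by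
  have h := congrArg Real.log hc
  rwa [Real.log_mul (Real.rpow_pos_of_pos hpq.pos _).ne'
    (Real.rpow_pos_of_pos hpq.symm.pos _).ne', Real.log_rpow two_pos, Real.log_rpow hpq.pos,
    Real.log_rpow hpq.symm.pos] at h

theorem one_le_exponent {p q c : ℝ} (hpq : p.HolderConjugate q)
    (hc : (2 : ℝ) ^ (1 / c) = p ^ (1 / p) * q ^ (1 / q)) : 1 ≤ c := by
  have hp0 := hpq.pos
  have hq0 := hpq.symm.pos
  have h2 : 0 < Real.log 2 := Real.log_pos one_lt_two
  have hpos : 0 < 1 / c := by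
    have h := log_two_div_eq hpq hc
    have h3 : 0 < 1 / p * Real.log p := mul_pos (by positivity) (Real.log_pos hpq.lt)
    have h4 : 0 < 1 / q * Real.log q := mul_pos (by positivity) (Real.log_pos hpq.symm.lt)
    exact (pos_iff_pos_of_mul_pos (by linarith : 0 < 1 / c * Real.log 2)).2 h2
  have hle : (2 : ℝ) ^ (1 / c) ≤ 2 ^ (1 : ℝ) := by
    rw [hc, Real.rpow_one]
    have := Real.geom_mean_le_arith_mean2_weighted (w₁ := 1 / p) (w₂ := 1 / q) (by positivity)
      (by positivity) hp0.le hq0.le (by simpa using hpq.inv_add_inv_eq_one)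
    refine this.trans_eq ?_
    field_simp
    norm_num
  have h1 := (Real.rpow_le_rpow_left_iff one_lt_two).1 hle
  have hc0 : 0 < c := one_div_pos.1 hpos
  rwa [div_le_one hc0] at h1

/-- The right-hand side divided by `1 - b` is the best constant `C` in
`C ‖g‖_p ‖h‖_q ≤ ∑ z, sup {g x h y, b g x' h y' | x + y = z, x' + y' = z - 1}` on `ℤ`, approached by
truncations of `g x = h x = b ^ x`, `x ≥ 0`; it has to be at least the `ℓ^c` norm of `(1, b)`. -/
theorem one_sub_mul_rpow_le {p q c b : ℝ} (hpq : p.HolderConjugate q)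
    (hc : (2 : ℝ) ^ (1 / c) = p ^ (1 / p) * q ^ (1 / q)) (hb0 : 0 < b) (hb1 : b < 1) :
    (1 - b) * (1 + b ^ c) ^ (1 / c) ≤ (1 - b ^ p) ^ (1 / p) * (1 - b ^ q) ^ (1 / q) := by
  wlog hqp : q ≤ p generalizing p q
  · rw [mul_comm (_ ^ _)]
    exact this hpq.symm (hc.trans (mul_comm _ _)) (le_of_not_ge hqp)
  have hlog := log_two_div_eq hpq hc
  have hc1 := one_le_exponent hpq hc
  have hp0 := hpq.pos
  have hq0 := hpq.symm.pos
  have h2 : 0 < Real.log 2 := Real.log_pos one_lt_two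
  have hp2 : 2 ≤ p := by
    have := hpq.mul_eq_add
    nlinarith
  have hcp : c ≤ p := by
    have h3 : 1 / p * Real.log 2 ≤ 1 / c * Real.log 2 := by
      rw [hlog]
      have h4 : 0 < 1 / q * Real.log q := mul_pos (by positivity) (Real.log_pos hpq.symm.lt)
      have h5 : 1 / p * Real.log 2 ≤ 1 / p * Real.log p :=
        mul_le_mul_of_nonneg_left (Real.log_le_log two_pos hp2) (by positivity)
      linarith
    exact (one_div_le_one_div hp0 (by linarith)).1 (le_of_mul_le_mul_right h3 h2)
  have hs : 0 < -Real.log b / 2 := by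
    have := Real.log_neg hb0 hb1
    linarith
  have key := log_one_sub_exp_nonneg hpq hqp hc1 hcp hlog hs
  have hexp : ∀ r : ℝ, Real.exp (-2 * (r * (-Real.log b / 2))) = b ^ r := fun r => by
    rw [Real.rpow_def_of_pos hb0]; ring_nf
  have h1 : Real.exp (-2 * (-Real.log b / 2)) = b := by
    rw [← one_mul (-Real.log b / 2), hexp, Real.rpow_one]
  rw [hexp, hexp, hexp, h1] at key
  have hlt : ∀ r : ℝ, 0 < r → 0 < 1 - b ^ r := fun r hr =>
    sub_pos.2 (Real.rpow_lt_one hb0.le hb1 hr)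
  have hbc : 0 < 1 + b ^ c := by positivity
  have hb1' : 0 < 1 - b := by linarith
  have hP := hlt p hp0
  have hQ := hlt q hq0
  rw [← Real.log_le_log_iff (by positivity) (by positivity),
    Real.log_mul (by positivity) (by positivity), Real.log_mul (by positivity) (by positivity),
    Real.log_rpow hbc, Real.log_rpow hP, Real.log_rpow hQ]
  linarith

/-! ### The one-dimensional Brunn–Minkowski inequality and level sets -/

/-- The sum of two compact sets contains the translates of `A` by `min B` and of `B` by `max A`. -/
theorem IsCompact.volume_add_volume_le {A B S : Set ℝ} (hA : IsCompact A) (hB : IsCompact B)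
    (hA' : A.Nonempty) (hB' : B.Nonempty) (hS : A + B ⊆ S) :
    volume A + volume B ≤ volume S := by
  obtain ⟨a, ha, hmax⟩ := hA.exists_isGreatest hA'
  obtain ⟨b, hb, hmin⟩ := hB.exists_isLeast hB'
  have h1 : volume ((fun x => x + b) '' A) = volume A := by simp
  have h2 : volume ((fun y => a + y) '' B) = volume B := by simp
  rw [← h1, ← h2, ← measure_union₀']
  · refine measure_mono (Set.union_subset ?_ ?_)
    · rintro _ ⟨x, hx, rfl⟩
      exact hS (Set.add_mem_add hx hb)
    · rintro _ ⟨y, hy, rfl⟩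
      exact hS (Set.add_mem_add ha hy)
  · exact (hA.image (by fun_prop)).measurableSet.nullMeasurableSet
  -- the two translates meet only in `a + b`
  · refine measure_mono_null (t := {a + b}) ?_ (by simp)
    rintro _ ⟨⟨x, hx, rfl⟩, ⟨y, hy, hxy⟩⟩
    have := hmax hx
    have := hmin hy
    simp only [Set.mem_singleton_iff] at *
    linarith

/-- The one-dimensional Brunn–Minkowski inequality. -/
theorem MeasurableSet.volume_add_volume_le {A B S : Set ℝ} (hA : MeasurableSet A)
    (hB : MeasurableSet B) (hA' : A.Nonempty) (hB' : B.Nonempty) (hS : A + B ⊆ S) :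
    volume A + volume B ≤ volume S := by
  have approx : ∀ {C : Set ℝ} {M : ℝ≥0∞}, MeasurableSet C →
      (∀ K ⊆ C, IsCompact K → K.Nonempty → volume K ≤ M) → volume C ≤ M := by
    intro C M hC h
    refine le_of_forall_lt fun r hr => ?_
    obtain ⟨K, hKC, hK, hrK⟩ := hC.exists_lt_isCompact hr
    exact hrK.trans_le (h K hKC hK (nonempty_of_measure_ne_zero (bot_le.trans_lt hrK).ne'))
  have left : ∀ K ⊆ A, IsCompact K → K.Nonempty → volume K + volume B ≤ volume S := by
    intro K hKA hK hK'
    have h : ∀ L ⊆ B, IsCompact L → L.Nonempty → volume K + volume L ≤ volume S :=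
      fun L hLB hL hL' => hK.volume_add_volume_le hL hK' hL' ((Set.add_subset_add hKA hLB).trans hS)
    obtain ⟨b, hb⟩ := hB'
    have hKS : volume K ≤ volume S := le_self_add.trans
      (h {b} (Set.singleton_subset_iff.2 hb) isCompact_singleton (Set.singleton_nonempty b))
    exact add_le_of_le_tsub_left_of_le hKS (approx hB fun L hLB hL hL' =>
      ENNReal.le_sub_of_add_le_left hK.measure_ne_top (h L hLB hL hL'))
  obtain ⟨a, ha⟩ := hA'
  have hBS : volume B ≤ volume S := le_add_self.trans
    (left {a} (Set.singleton_subset_iff.2 ha) isCompact_singleton (Set.singleton_nonempty a))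
  by_cases hBtop : volume B = ∞
  · rw [hBtop, top_le_iff] at hBS
    exact hBS ▸ le_top
  · exact add_le_of_le_tsub_right_of_le hBS (approx hA fun K hKA hK hK' =>
      ENNReal.le_sub_of_add_le_right hBtop (left K hKA hK hK'))

/-- A Prékopa–Leindler type inequality on `ℝ`. For `t < 1` the level set `{t < k}` contains the sum of
the level sets `{t < u ^ p}` and `{t < v ^ q}`, which are nonempty because the maxima are `1`. -/
theorem lintegral_rpow_add_lintegral_rpow_le {u v k : ℝ → ℝ} {p q : ℝ} (hp : 0 < p) (hq : 0 < q)
    (hpq : 1 / p + 1 / q = 1)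
    (hu : Measurable u) (hv : Measurable v) (hk : Measurable k) (hu0 : ∀ x, 0 ≤ u x)
    (hv0 : ∀ x, 0 ≤ v x) (hk0 : ∀ x, 0 ≤ k x) (hu1 : ∀ x, u x ≤ 1) (hv1 : ∀ x, v x ≤ 1)
    {x₀ y₀ : ℝ} (hx₀ : u x₀ = 1) (hy₀ : v y₀ = 1) (h : ∀ x y, u x * v y ≤ k (x + y)) :
    (∫⁻ x, ENNReal.ofReal (u x ^ p)) + (∫⁻ x, ENNReal.ofReal (v x ^ q)) ≤
      ∫⁻ x, ENNReal.ofReal (k x) := by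
  have hup : Measurable fun x => u x ^ p := hu.pow_const p
  have hvq : Measurable fun x => v x ^ q := hv.pow_const q
  rw [lintegral_eq_lintegral_meas_lt _ (.of_forall fun x => Real.rpow_nonneg (hu0 x) p)
      hup.aemeasurable,
    lintegral_eq_lintegral_meas_lt _ (.of_forall fun x => Real.rpow_nonneg (hv0 x) q)
      hvq.aemeasurable,
    lintegral_eq_lintegral_meas_lt _ (.of_forall hk0) hk.aemeasurable,
    ← lintegral_add_left]
  · refine setLIntegral_mono' measurableSet_Ioi fun t (ht : 0 < t) => ?_
    rcases lt_or_ge t 1 with ht1 | ht1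
    · refine MeasurableSet.volume_add_volume_le (measurableSet_lt measurable_const hup)
        (measurableSet_lt measurable_const hvq) ⟨x₀, by simpa [hx₀] using ht1⟩
        ⟨y₀, by simpa [hy₀] using ht1⟩ ?_
      rintro _ ⟨x, hx, y, hy, rfl⟩
      refine lt_of_lt_of_le ?_ (h x y)
      have key : ∀ {a r : ℝ}, 0 < r → 0 ≤ a → t < a ^ r → t ^ (1 / r) < a := by
        intro a r hr ha hta
        have := Real.rpow_lt_rpow ht.le hta (one_div_pos.2 hr)
        rwa [← Real.rpow_mul ha, mul_one_div_cancel hr.ne', Real.rpow_one] at this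
      calc t = t ^ (1 / p) * t ^ (1 / q) := by rw [← Real.rpow_add ht, hpq, Real.rpow_one]
        _ < u x * v y := mul_lt_mul'' (key hp (hu0 x) hx) (key hq (hv0 y) hy)
          (Real.rpow_nonneg ht.le _) (Real.rpow_nonneg ht.le _)
    · have e1 : {a | t < u a ^ p} = ∅ := Set.eq_empty_of_forall_notMem fun a (ha : t < u a ^ p) =>
        absurd (Real.rpow_le_one (hu0 a) (hu1 a) hp.le) (not_le.2 (ht1.trans_lt ha))
      have e2 : {a | t < v a ^ q} = ∅ := Set.eq_empty_of_forall_notMem fun a (ha : t < v a ^ q) =>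
        absurd (Real.rpow_le_one (hv0 a) (hv1 a) hq.le) (not_le.2 (ht1.trans_lt ha))
      simp [e1, e2]
  · exact Antitone.measurable fun s t hst => measure_mono fun a (ha : t < u a ^ p) =>
      hst.trans_lt ha

theorem lintegral_fract_mul_floor {φ : ℝ → ℝ≥0∞} (hφ : Measurable φ) (G : ℤ → ℝ≥0∞) :
    ∫⁻ x, φ (Int.fract x) * G ⌊x⌋ = (∫⁻ x in Set.Ico 0 1, φ x) * ∑' z, G z := by
  rw [← setLIntegral_univ, ← iUnion_Ico_intCast ℝ, lintegral_iUnion (fun _ => measurableSet_Ico)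
    (by simpa using Set.pairwise_disjoint_Ico_intCast ℝ), ← ENNReal.tsum_mul_left]
  refine tsum_congr fun n => ?_
  have e1 : ∫⁻ x in Set.Ico (n : ℝ) (n + 1), φ (Int.fract x) * G ⌊x⌋ =
      ∫⁻ x in Set.Ico (n : ℝ) (n + 1), φ (x - n) * G n := by
    refine setLIntegral_congr_fun measurableSet_Ico fun x hx => ?_
    have : ⌊x⌋ = n := Int.floor_eq_iff.2 hx
    simp only [Int.fract, this]
  rw [e1, lintegral_mul_const _ (by fun_prop)]
  congr 1
  have hmp : MeasurePreserving (fun x : ℝ => x - n) volume volume :=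
    measurePreserving_sub_right volume (n : ℝ)
  have := hmp.setLIntegral_comp_preimage (measurableSet_Ico (a := (0:ℝ)) (b := 1)) hφ
  rw [← this]
  congr 2
  ext x
  simp [add_comm]

/-! ### Passing from `ℤ` to `ℝ` -/

/-- Extending `g`, `h`, `K` to step functions on `ℝ` tilted by `b ^ fract x` turns the two
hypotheses, for the shifts `0` and `1` with weights `1` and `b`, into a single inequality on `ℝ`:
`⌊x + y⌋` is `⌊x⌋ + ⌊y⌋` or `⌊x⌋ + ⌊y⌋ + 1`, and in the second case
`fract (x + y) = fract x + fract y - 1`. -/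
theorem tsum_mul_lintegral_add_le {p q b : ℝ} (hpq : p.HolderConjugate q) (hb0 : 0 < b)
    (hb1 : b ≤ 1) {g h K : ℤ → ℝ} (hg0 : ∀ x, 0 ≤ g x) (hh0 : ∀ x, 0 ≤ h x) (hK0 : ∀ x, 0 ≤ K x)
    (hg1 : ∀ x, g x ≤ 1) (hh1 : ∀ x, h x ≤ 1) {x₀ y₀ : ℤ} (hx₀ : g x₀ = 1) (hy₀ : h y₀ = 1)
    (hK : ∀ x y, g x * h y ≤ K (x + y)) (hK' : ∀ x y, b * (g x * h y) ≤ K (x + y + 1)) :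
    (∫⁻ x in Set.Ico (0 : ℝ) 1, ENNReal.ofReal (b ^ (p * x))) * ∑' z, ENNReal.ofReal (g z ^ p) +
      (∫⁻ x in Set.Ico (0 : ℝ) 1, ENNReal.ofReal (b ^ (q * x))) * ∑' z, ENNReal.ofReal (h z ^ q) ≤
      (∫⁻ x in Set.Ico (0 : ℝ) 1, ENNReal.ofReal (b ^ x)) * ∑' z, ENNReal.ofReal (K z) := by
  have hmeas : ∀ r : ℝ, Measurable fun x : ℝ => ENNReal.ofReal (b ^ (r * x)) := fun r => by
    have : Continuous fun x : ℝ => b ^ (r * x) :=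
      continuous_const.rpow (by fun_prop) fun _ => Or.inl hb0.ne'
    exact this.measurable.ennreal_ofReal
  have hstep : ∀ G : ℤ → ℝ, Measurable fun x : ℝ => b ^ Int.fract x * G ⌊x⌋ := fun G => by
    have h1 : Continuous fun x : ℝ => b ^ x :=
      continuous_const.rpow continuous_id fun _ => Or.inl hb0.ne'
    exact (h1.measurable.comp measurable_fract).mul
      ((measurable_from_top (f := G)).comp Int.measurable_floor)
  have hb : ∀ x : ℝ, 0 < b ^ x := fun x => Real.rpow_pos_of_pos hb0 x
  have hle : ∀ x : ℝ, b ^ Int.fract x ≤ 1 := fun x =>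
    Real.rpow_le_one hb0.le hb1 (Int.fract_nonneg x)
  have key := lintegral_rpow_add_lintegral_rpow_le (u := fun x => b ^ Int.fract x * g ⌊x⌋)
    (v := fun x => b ^ Int.fract x * h ⌊x⌋) (k := fun x => b ^ Int.fract x * K ⌊x⌋)
    hpq.pos hpq.symm.pos (by simpa using hpq.inv_add_inv_eq_one) (hstep g) (hstep h) (hstep K)
    (fun x => mul_nonneg (hb _).le (hg0 _)) (fun x => mul_nonneg (hb _).le (hh0 _))
    (fun x => mul_nonneg (hb _).le (hK0 _)) (fun x => mul_le_one₀ (hle x) (hg0 _) (hg1 _))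
    (fun x => mul_le_one₀ (hle x) (hh0 _) (hh1 _)) (x₀ := x₀) (y₀ := y₀) (by simp [hx₀])
    (by simp [hy₀]) (by
      intro x y
      have e : b ^ Int.fract x * g ⌊x⌋ * (b ^ Int.fract y * h ⌊y⌋) =
          b ^ (Int.fract x + Int.fract y) * (g ⌊x⌋ * h ⌊y⌋) := by
        rw [Real.rpow_add hb0]; ring
      rw [e]
      rcases lt_or_ge (Int.fract x + Int.fract y) 1 with hlt | hge
      · have hfl : ⌊x + y⌋ = ⌊x⌋ + ⌊y⌋ := by
          rw [Int.floor_eq_iff]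
          push_cast
          have := Int.fract_nonneg x
          have := Int.fract_nonneg y
          unfold Int.fract at *
          constructor <;> linarith
        have hfr : Int.fract (x + y) = Int.fract x + Int.fract y := by
          unfold Int.fract
          rw [hfl]; push_cast; ring
        rw [hfl, hfr]
        exact mul_le_mul_of_nonneg_left (hK _ _) (hb _).le
      · have hfl : ⌊x + y⌋ = ⌊x⌋ + ⌊y⌋ + 1 := by
          rw [Int.floor_eq_iff]
          push_cast
          have := Int.fract_lt_one x
          have := Int.fract_lt_one y
          unfold Int.fract at *
          constructor <;> linarith
        have hfr : Int.fract x + Int.fract y = Int.fract (x + y) + 1 := by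
          unfold Int.fract
          rw [hfl]; push_cast; ring
        rw [hfl, hfr, Real.rpow_add hb0, Real.rpow_one, mul_assoc]
        exact mul_le_mul_of_nonneg_left (hK' _ _) (hb _).le)
  have hpow : ∀ (r : ℝ) (G : ℤ → ℝ), (∀ z, 0 ≤ G z) → ∀ x : ℝ,
      ENNReal.ofReal ((b ^ Int.fract x * G ⌊x⌋) ^ r) =
        ENNReal.ofReal (b ^ (r * Int.fract x)) * ENNReal.ofReal (G ⌊x⌋ ^ r) := by
    intro r G hG x
    rw [Real.mul_rpow (hb _).le (hG _), ← Real.rpow_mul hb0.le, mul_comm r,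
      ENNReal.ofReal_mul (hb _).le]
  have hone := hpow 1 K hK0
  simp only [Real.rpow_one, one_mul] at hone
  have h1 := hmeas 1
  simp only [one_mul] at h1
  simp only [hpow p g hg0, hpow q h hh0, hone] at key
  rw [lintegral_fract_mul_floor (hmeas p) fun z => ENNReal.ofReal (g z ^ p),
    lintegral_fract_mul_floor (hmeas q) fun z => ENNReal.ofReal (h z ^ q),
    lintegral_fract_mul_floor h1 fun z => ENNReal.ofReal (K z)] at key
  exact key

theorem lintegral_rpow_Ico {b r : ℝ} (hb0 : 0 < b) (hb1 : b < 1) (hr : 0 < r) :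
    ∫⁻ x in Set.Ico (0 : ℝ) 1, ENNReal.ofReal (b ^ (r * x)) =
      ENNReal.ofReal ((1 - b ^ r) / (r * -Real.log b)) := by
  have hlog := Real.log_neg hb0 hb1
  have hcont : Continuous fun x : ℝ => b ^ (r * x) :=
    continuous_const.rpow (by fun_prop) fun _ => Or.inl hb0.ne'
  rw [← ofReal_integral_eq_lintegral_ofReal
      ((hcont.integrableOn_Icc (a := 0) (b := 1)).mono_set Set.Ico_subset_Icc_self)
      (.of_forall fun x => Real.rpow_nonneg hb0.le _),
    integral_Ico_eq_integral_Ioc, ← intervalIntegral.integral_of_le zero_le_one]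
  congr 1
  have hder : ∀ x ∈ Set.uIcc (0 : ℝ) 1,
      HasDerivAt (fun x => b ^ (r * x) / (r * Real.log b)) (b ^ (r * x)) x := by
    intro x _
    have hlin : HasDerivAt (fun x : ℝ => r * x) r x := by
      simpa using (hasDerivAt_id x).const_mul r
    refine ((hlin.const_rpow hb0).div_const (r * Real.log b)).congr_deriv ?_
    have := hlog.ne
    field_simp
  rw [intervalIntegral.integral_eq_sub_of_hasDerivAt hder (hcont.intervalIntegrable _ _)]
  have := hlog.ne
  simp
  field_simp
  ring

/-! ### The inequality on `ℤ` -/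

/-- The arithmetic-geometric mean inequality followed by the comparison of constants; the factors
are the integrals of `b ^ (p x)`, `b ^ (q x)` and `b ^ x` over `[0, 1)`. -/
theorem rpow_mul_rpow_le_of_add_le {p q c b x y S : ℝ} (hpq : p.HolderConjugate q)
    (hc : (2 : ℝ) ^ (1 / c) = p ^ (1 / p) * q ^ (1 / q)) (hb0 : 0 < b) (hb1 : b < 1)
    (hx : 0 ≤ x) (hy : 0 ≤ y)
    (h : (1 - b ^ p) / (p * -Real.log b) * x + (1 - b ^ q) / (q * -Real.log b) * y ≤
      (1 - b) / -Real.log b * S) :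
    (1 + b ^ c) ^ (1 / c) * x ^ (1 / p) * y ^ (1 / q) ≤ S := by
  have hlog : 0 < -Real.log b := neg_pos.2 (Real.log_neg hb0 hb1)
  have hp0 := hpq.pos
  have hq0 := hpq.symm.pos
  have hP : 0 < 1 - b ^ p := sub_pos.2 (Real.rpow_lt_one hb0.le hb1 hp0)
  have hQ : 0 < 1 - b ^ q := sub_pos.2 (Real.rpow_lt_one hb0.le hb1 hq0)
  have h1 : 1 / p * ((1 - b ^ p) * x) + 1 / q * ((1 - b ^ q) * y) ≤ (1 - b) * S := by
    have := mul_le_mul_of_nonneg_left h hlog.le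
    generalize -Real.log b = L at *
    refine (le_of_eq ?_).trans (this.trans_eq ?_) <;> field_simp
  have h2 := Real.geom_mean_le_arith_mean2_weighted (w₁ := 1 / p) (w₂ := 1 / q) (by positivity)
      (by positivity) (mul_nonneg hP.le hx) (mul_nonneg hQ.le hy)
      (by simpa using hpq.inv_add_inv_eq_one)
  rw [Real.mul_rpow hP.le hx, Real.mul_rpow hQ.le hy] at h2
  have h3 := mul_le_mul_of_nonneg_right (one_sub_mul_rpow_le hpq hc hb0 hb1)
    (mul_nonneg (Real.rpow_nonneg hx (1 / p)) (Real.rpow_nonneg hy (1 / q)))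
  refine le_of_mul_le_mul_left (a := 1 - b) ?_ (by linarith)
  linarith

/-- The analogue of `rpow_mul_rpow_le_of_add_le` for `b = 1`, where the definition of `c` makes the
constants agree. -/
theorem rpow_mul_rpow_le_add {p q c x y : ℝ} (hpq : p.HolderConjugate q)
    (hc : (2 : ℝ) ^ (1 / c) = p ^ (1 / p) * q ^ (1 / q)) (hx : 0 ≤ x) (hy : 0 ≤ y) :
    2 ^ (1 / c) * x ^ (1 / p) * y ^ (1 / q) ≤ x + y := by
  have hp0 := hpq.pos
  have hq0 := hpq.symm.pos
  have h2 := Real.geom_mean_le_arith_mean2_weighted (w₁ := 1 / p) (w₂ := 1 / q) (by positivity)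
      (by positivity) (mul_nonneg hp0.le hx) (mul_nonneg hq0.le hy)
      (by simpa using hpq.inv_add_inv_eq_one)
  rw [Real.mul_rpow hp0.le hx, Real.mul_rpow hq0.le hy] at h2
  have e1 : 1 / p * (p * x) = x := by field_simp
  have e2 : 1 / q * (q * y) = y := by field_simp
  rw [hc]
  linarith

/-- The inequality on `ℤ` for the weights `(1, b)`, with `g` and `h` normalised to have
maximum `1`. -/
theorem ofReal_mul_tsum_rpow_le {p q c b : ℝ} (hpq : p.HolderConjugate q)
    (hc : (2 : ℝ) ^ (1 / c) = p ^ (1 / p) * q ^ (1 / q)) (hb0 : 0 ≤ b)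
    (hb1 : b ≤ 1) {g h K : ℤ → ℝ} (hg0 : ∀ x, 0 ≤ g x) (hh0 : ∀ x, 0 ≤ h x) (hK0 : ∀ x, 0 ≤ K x)
    (hg1 : ∀ x, g x ≤ 1) (hh1 : ∀ x, h x ≤ 1) {x₀ y₀ : ℤ} (hx₀ : g x₀ = 1) (hy₀ : h y₀ = 1)
    (hK : ∀ x y, g x * h y ≤ K (x + y)) (hK' : ∀ x y, b * (g x * h y) ≤ K (x + y + 1))
    (hg : ∑' z, ENNReal.ofReal (g z ^ p) ≠ ∞) (hh : ∑' z, ENNReal.ofReal (h z ^ q) ≠ ∞) :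
    ENNReal.ofReal ((1 + b ^ c) ^ (1 / c)) * (∑' z, ENNReal.ofReal (g z ^ p)) ^ (1 / p) *
      (∑' z, ENNReal.ofReal (h z ^ q)) ^ (1 / q) ≤ ∑' z, ENNReal.ofReal (K z) := by
  have hp0 := hpq.pos
  have hq0 := hpq.symm.pos
  have hc1 := one_le_exponent hpq hc
  have hinv : 1 / p + 1 / q = 1 := by simpa using hpq.inv_add_inv_eq_one
  by_cases hS : ∑' z, ENNReal.ofReal (K z) = ∞
  · rw [hS]; exact le_top
  have toReal : ∀ {X Y S : ℝ≥0∞} {C : ℝ}, 0 ≤ C → X ≠ ∞ → Y ≠ ∞ → S ≠ ∞ →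
      C * X.toReal ^ (1 / p) * Y.toReal ^ (1 / q) ≤ S.toReal →
      ENNReal.ofReal C * X ^ (1 / p) * Y ^ (1 / q) ≤ S := by
    intro X Y S C hC hX hY hS h
    have := ENNReal.ofReal_le_ofReal h
    rwa [ENNReal.ofReal_mul (by positivity), ENNReal.ofReal_mul hC,
      ← ENNReal.ofReal_rpow_of_nonneg ENNReal.toReal_nonneg (by positivity),
      ← ENNReal.ofReal_rpow_of_nonneg ENNReal.toReal_nonneg (by positivity),
      ENNReal.ofReal_toReal hX, ENNReal.ofReal_toReal hY, ENNReal.ofReal_toReal hS] at this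
  rcases hb0.eq_or_lt with rfl | hb0
  -- for `b = 0` there is no tilt; but then `∑ K` dominates both `∑ g ^ p` and `∑ h ^ q`
  · have hgS : ∑' z, ENNReal.ofReal (g z ^ p) ≤ ∑' z, ENNReal.ofReal (K z) := by
      rw [← (Equiv.addRight y₀).tsum_eq fun z => ENNReal.ofReal (K z)]
      refine ENNReal.tsum_le_tsum fun x => ENNReal.ofReal_le_ofReal ?_
      have h1 := Real.rpow_le_rpow_of_exponent_ge' (hg0 x) (hg1 x) zero_le_one hpq.lt.le
      rw [Real.rpow_one] at h1
      have := hK x y₀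
      rw [hy₀, mul_one] at this
      exact h1.trans this
    have hhS : ∑' z, ENNReal.ofReal (h z ^ q) ≤ ∑' z, ENNReal.ofReal (K z) := by
      rw [← (Equiv.addLeft x₀).tsum_eq fun z => ENNReal.ofReal (K z)]
      refine ENNReal.tsum_le_tsum fun x => ENNReal.ofReal_le_ofReal ?_
      have h1 := Real.rpow_le_rpow_of_exponent_ge' (hh0 x) (hh1 x) zero_le_one hpq.symm.lt.le
      rw [Real.rpow_one] at h1
      have := hK x₀ x
      rw [hx₀, one_mul] at this
      exact h1.trans this
    rw [Real.zero_rpow (by linarith), add_zero, Real.one_rpow, ENNReal.ofReal_one, one_mul]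
    refine (mul_le_mul' (ENNReal.rpow_le_rpow hgS (by positivity))
      (ENNReal.rpow_le_rpow hhS (by positivity))).trans_eq ?_
    rw [← ENNReal.rpow_add_of_nonneg _ _ (by positivity) (by positivity), hinv, ENNReal.rpow_one]
  have key := tsum_mul_lintegral_add_le hpq hb0 hb1 hg0 hh0 hK0 hg1 hh1 hx₀ hy₀ hK hK'
  refine toReal (by positivity) hg hh hS ?_
  generalize (∑' z, ENNReal.ofReal (g z ^ p)) = X at *
  generalize (∑' z, ENNReal.ofReal (h z ^ q)) = Y at *
  generalize (∑' z, ENNReal.ofReal (K z)) = S at *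
  rcases hb1.eq_or_lt with rfl | hb1
  · simp only [Real.one_rpow, ENNReal.ofReal_one, lintegral_const, Measure.restrict_apply,
      MeasurableSet.univ, Set.univ_inter, Real.volume_Ico, sub_zero, one_mul] at key ⊢
    rw [one_add_one_eq_two]
    refine (rpow_mul_rpow_le_add hpq hc ENNReal.toReal_nonneg ENNReal.toReal_nonneg).trans ?_
    rw [← ENNReal.toReal_add hg hh]
    exact ENNReal.toReal_mono hS key
  · have h1 := lintegral_rpow_Ico hb0 hb1 one_pos
    simp only [one_mul, Real.rpow_one] at h1
    rw [lintegral_rpow_Ico hb0 hb1 hp0, lintegral_rpow_Ico hb0 hb1 hq0, h1] at key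
    have hlog : 0 < -Real.log b := neg_pos.2 (Real.log_neg hb0 hb1)
    have hP : 0 < 1 - b ^ p := sub_pos.2 (Real.rpow_lt_one hb0.le hb1 hp0)
    have hQ : 0 < 1 - b ^ q := sub_pos.2 (Real.rpow_lt_one hb0.le hb1 hq0)
    have hB : 0 < 1 - b := sub_pos.2 hb1
    refine rpow_mul_rpow_le_of_add_le hpq hc hb0 hb1 ENNReal.toReal_nonneg
      ENNReal.toReal_nonneg ?_
    have := ENNReal.toReal_mono (ENNReal.mul_ne_top ENNReal.ofReal_ne_top hS) key
    rwa [ENNReal.toReal_add (ENNReal.mul_ne_top ENNReal.ofReal_ne_top hg)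
      (ENNReal.mul_ne_top ENNReal.ofReal_ne_top hh), ENNReal.toReal_mul, ENNReal.toReal_mul,
      ENNReal.toReal_mul, ENNReal.toReal_ofReal (by positivity),
      ENNReal.toReal_ofReal (by positivity), ENNReal.toReal_ofReal (by positivity)] at this

/-- The `ℓ^r` norm of an extended nonnegative function, so that no summability is needed. -/
noncomputable def lpSum {E : Type*} (r : ℝ) (f : E → ℝ≥0∞) : ℝ≥0∞ :=
  (∑' x, f x ^ r) ^ (1 / r)

theorem lpSum_const_mul {E : Type*} {r : ℝ} (hr : 0 < r) (a : ℝ≥0∞) (f : E → ℝ≥0∞) :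
    lpSum r (fun x => a * f x) = a * lpSum r f := by
  simp only [lpSum, ENNReal.mul_rpow_of_nonneg _ _ hr.le, ENNReal.tsum_mul_left]
  rw [ENNReal.mul_rpow_of_nonneg _ _ (by positivity), ← ENNReal.rpow_mul,
    mul_one_div_cancel hr.ne', ENNReal.rpow_one]

theorem lpSum_rpow {E : Type*} {r : ℝ} (hr : 0 < r) (f : E → ℝ≥0∞) :
    lpSum r f ^ r = ∑' x, f x ^ r := by
  rw [lpSum, ← ENNReal.rpow_mul, one_div_mul_cancel hr.ne', ENNReal.rpow_one]

theorem tsum_rpow_ne_top {E : Type*} {r : ℝ} (hr : 0 < r) {f : E → ℝ≥0∞}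
    (hf : f.support.Finite) (hf' : ∀ x, f x ≠ ∞) : ∑' x, f x ^ r ≠ ∞ := by
  rw [tsum_eq_sum (s := hf.toFinset) fun x hx => by
    have : f x = 0 := by simpa using hx
    rw [this, ENNReal.zero_rpow_of_pos hr]]
  exact ENNReal.sum_ne_top.2 fun x _ => ENNReal.rpow_ne_top_of_nonneg hr.le (hf' x)

theorem lpSum_ne_top {E : Type*} {r : ℝ} (hr : 0 < r) {f : E → ℝ≥0∞}
    (hf : f.support.Finite) (hf' : ∀ x, f x ≠ ∞) : lpSum r f ≠ ∞ :=
  ENNReal.rpow_ne_top_of_nonneg (by positivity) (tsum_rpow_ne_top hr hf hf')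

theorem lpSum_zero {E : Type*} {r : ℝ} (hr : 0 < r) : lpSum r (fun _ : E => 0) = 0 := by
  simp [lpSum, ENNReal.zero_rpow_of_pos hr, hr]

theorem exists_forall_le_of_support_finite {E : Type*} {g : E → ℝ≥0∞} (hg : g.support.Finite)
    (hg0 : g ≠ fun _ => 0) : ∃ x₀, g x₀ ≠ 0 ∧ ∀ x, g x ≤ g x₀ := by
  obtain ⟨x₁, hx₁⟩ := Function.ne_iff.1 hg0
  obtain ⟨x₀, hx₀, hmax⟩ := hg.exists_maximalFor g _ ⟨x₁, hx₁⟩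
  refine ⟨x₀, hx₀, fun x => ?_⟩
  by_cases hx : g x = 0
  · simp [hx]
  · exact (le_total (g x) (g x₀)).elim id fun h => hmax hx h

/-- The case of `ℤ` where the larger weight is at `0`. -/
theorem rpow_add_rpow_mul_lpSum_le {p q c : ℝ} (hpq : p.HolderConjugate q)
    (hc : (2 : ℝ) ^ (1 / c) = p ^ (1 / p) * q ^ (1 / q)) {a b : ℝ≥0∞} (hba : b ≤ a) (ha : a ≠ ∞)
    {g h K : ℤ → ℝ≥0∞} (hg : g.support.Finite) (hh : h.support.Finite) (hg' : ∀ x, g x ≠ ∞)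
    (hh' : ∀ x, h x ≠ ∞) (hK : ∀ x y, a * g x * h y ≤ K (x + y))
    (hK' : ∀ x y, b * g x * h y ≤ K (x + y + 1)) :
    (a ^ c + b ^ c) ^ (1 / c) * lpSum p g * lpSum q h ≤ ∑' z, K z := by
  have hp0 := hpq.pos
  have hq0 := hpq.symm.pos
  have hc0 : 0 < c := one_pos.trans_le (one_le_exponent hpq hc)
  by_cases hg0 : g = fun _ => 0
  · simp [hg0, lpSum_zero hp0]
  by_cases hh0 : h = fun _ => 0
  · simp [hh0, lpSum_zero hq0]
  by_cases ha0 : a = 0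
  · have hb0 : b = 0 := le_antisymm (ha0 ▸ hba) bot_le
    simp [ha0, hb0, ENNReal.zero_rpow_of_pos hc0, hc0]
  obtain ⟨x₀, hx₀, hxm⟩ := exists_forall_le_of_support_finite hg hg0
  obtain ⟨y₀, hy₀, hym⟩ := exists_forall_le_of_support_finite hh hh0
  set M := g x₀ with hM
  set N := h y₀ with hN
  have hMt : M ≠ ∞ := hg' x₀
  have hNt : N ≠ ∞ := hh' y₀
  have hT0 : a * M * N ≠ 0 := mul_ne_zero (mul_ne_zero ha0 hx₀) hy₀
  have hTt : a * M * N ≠ ∞ := ENNReal.mul_ne_top (ENNReal.mul_ne_top ha hMt) hNt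
  have hb1 : b / a ≤ 1 := ENNReal.div_le_of_le_mul (by simpa using hba)
  have hg1 : ∀ x, g x / M ≤ 1 := fun x => ENNReal.div_le_of_le_mul (by simpa using hxm x)
  have hh1 : ∀ x, h x / N ≤ 1 := fun x => ENNReal.div_le_of_le_mul (by simpa using hym x)
  have top : ∀ {x : ℝ≥0∞}, x ≤ 1 → x ≠ ∞ := fun hx => ne_top_of_le_ne_top ENNReal.one_ne_top hx
  have eg : ∀ x, ENNReal.ofReal ((g x / M).toReal ^ p) = (g x / M) ^ p := fun x => by
    rw [← ENNReal.ofReal_rpow_of_nonneg ENNReal.toReal_nonneg hp0.le,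
      ENNReal.ofReal_toReal (top (hg1 x))]
  have eh : ∀ x, ENNReal.ofReal ((h x / N).toReal ^ q) = (h x / N) ^ q := fun x => by
    rw [← ENNReal.ofReal_rpow_of_nonneg ENNReal.toReal_nonneg hq0.le,
      ENNReal.ofReal_toReal (top (hh1 x))]
  have hmul : ∀ x y, g x * h y = (g x / M) * (h y / N) * (M * N) := fun x y => by
    rw [mul_mul_mul_comm, ENNReal.div_mul_cancel hx₀ hMt, ENNReal.div_mul_cancel hy₀ hNt]
  -- truncation at `1` makes `K` finite without losing either hypothesis
  have hmin : ∀ z, min (K z / (a * M * N)) 1 ≤ 1 := fun z => min_le_right _ _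
  have key := ofReal_mul_tsum_rpow_le hpq hc (b := (b / a).toReal)
    (g := fun x => (g x / M).toReal) (h := fun x => (h x / N).toReal)
    (K := fun z => (min (K z / (a * M * N)) 1).toReal) ENNReal.toReal_nonneg
    (ENNReal.toReal_le_of_le_ofReal zero_le_one (by simpa using hb1))
    (fun _ => ENNReal.toReal_nonneg) (fun _ => ENNReal.toReal_nonneg)
    (fun _ => ENNReal.toReal_nonneg)
    (fun x => ENNReal.toReal_le_of_le_ofReal zero_le_one (by simpa using hg1 x))
    (fun x => ENNReal.toReal_le_of_le_ofReal zero_le_one (by simpa using hh1 x))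
    (x₀ := x₀) (y₀ := y₀) (by simp [← hM, ENNReal.div_self hx₀ hMt])
    (by simp [← hN, ENNReal.div_self hy₀ hNt])
    (by
      intro x y
      rw [← ENNReal.toReal_mul]
      refine ENNReal.toReal_mono (top (hmin _)) (le_min ?_ (mul_le_one' (hg1 x) (hh1 y)))
      rw [ENNReal.le_div_iff_mul_le (Or.inl hT0) (Or.inl hTt)]
      refine (le_of_eq ?_).trans (hK x y)
      rw [mul_assoc a, mul_assoc a, hmul x y]
      ring)
    (by
      intro x y
      rw [← ENNReal.toReal_mul, ← ENNReal.toReal_mul]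
      refine ENNReal.toReal_mono (top (hmin _))
        (le_min ?_ (mul_le_one' hb1 (mul_le_one' (hg1 x) (hh1 y))))
      rw [ENNReal.le_div_iff_mul_le (Or.inl hT0) (Or.inl hTt)]
      refine (le_of_eq ?_).trans (hK' x y)
      have hb : b = b / a * a := (ENNReal.div_mul_cancel ha0 ha).symm
      conv_rhs => rw [hb]
      rw [mul_assoc (b / a * a), hmul x y]
      ring)
    (by
      simp only [eg]
      refine tsum_rpow_ne_top hp0 (hg.subset fun x hx => ?_) fun x => top (hg1 x)
      intro h0
      exact hx (by simp [h0]))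
    (by
      simp only [eh]
      refine tsum_rpow_ne_top hq0 (hh.subset fun x hx => ?_) fun x => top (hh1 x)
      intro h0
      exact hx (by simp [h0]))
  have hbt := top hb1
  simp only [eg, eh, fun z => ENNReal.ofReal_toReal (top (hmin z))] at key
  have e1 : ENNReal.ofReal ((1 + (b / a).toReal ^ c) ^ (1 / c)) =
      (1 + (b / a) ^ c) ^ (1 / c) := by
    rw [← ENNReal.ofReal_rpow_of_nonneg (by positivity) (by positivity),
      ENNReal.ofReal_add zero_le_one (by positivity), ENNReal.ofReal_one,
      ← ENNReal.ofReal_rpow_of_nonneg ENNReal.toReal_nonneg hc0.le, ENNReal.ofReal_toReal hbt]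
  have e2 : (a ^ c + b ^ c) ^ (1 / c) = a * (1 + (b / a) ^ c) ^ (1 / c) := by
    have hb : b ^ c = a ^ c * (b / a) ^ c := by
      rw [← ENNReal.mul_rpow_of_nonneg _ _ hc0.le, mul_comm, ENNReal.div_mul_cancel ha0 ha]
    rw [hb, ← mul_one_add, ENNReal.mul_rpow_of_nonneg _ _ (by positivity), ← ENNReal.rpow_mul,
      mul_one_div_cancel hc0.ne', ENNReal.rpow_one]
  have e3 : lpSum p g = M * lpSum p fun x => g x / M := by
    rw [← lpSum_const_mul hp0]
    simp only [ENNReal.mul_div_cancel hx₀ hMt]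
  have e4 : lpSum q h = N * lpSum q fun x => h x / N := by
    rw [← lpSum_const_mul hq0]
    simp only [ENNReal.mul_div_cancel hy₀ hNt]
  rw [e1] at key
  calc (a ^ c + b ^ c) ^ (1 / c) * lpSum p g * lpSum q h
      = (a * M * N) * ((1 + (b / a) ^ c) ^ (1 / c) * (lpSum p fun x => g x / M) *
        lpSum q fun x => h x / N) := by rw [e2, e3, e4]; ring
    _ ≤ (a * M * N) * ∑' z, min (K z / (a * M * N)) 1 := mul_le_mul_right key _
    _ = ∑' z, (a * M * N) * min (K z / (a * M * N)) 1 := ENNReal.tsum_mul_left.symm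
    _ ≤ ∑' z, K z := ENNReal.tsum_le_tsum fun z =>
      (mul_le_mul_right (min_le_left _ _) _).trans ENNReal.mul_div_le

/-! ### Tensorization and the discrete cube -/

/-- The inequality `‖f‖_c ‖g‖_p ‖h‖_q ≤ ‖K‖₁` on an abelian group `E`, for finitely supported
`g`, `h` and for `f` supported on `C`. The sup-convolution of the three functions is replaced by
an arbitrary `K` that dominates all the products. -/
def SupConvIneq (c p q : ℝ) {E : Type*} [AddCommGroup E] (C : Set E) : Prop :=
  ∀ f g h K : E → ℝ≥0∞, f.support ⊆ C → g.support.Finite → h.support.Finite →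
    (∀ x, f x ≠ ∞) → (∀ x, g x ≠ ∞) → (∀ x, h x ≠ ∞) →
    (∀ x y z, f x * g y * h z ≤ K (x + y + z)) →
    lpSum c f * lpSum p g * lpSum q h ≤ ∑' z, K z

theorem supConvIneq_int {p q c : ℝ} (hpq : p.HolderConjugate q)
    (hc : (2 : ℝ) ^ (1 / c) = p ^ (1 / p) * q ^ (1 / q)) :
    SupConvIneq c p q ({0, 1} : Set ℤ) := by
  intro f g h K hf hg hh hf' hg' hh' hK
  have hc0 : 0 < c := one_pos.trans_le (one_le_exponent hpq hc)
  have e : lpSum c f = (f 0 ^ c + f 1 ^ c) ^ (1 / c) := by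
    rw [lpSum, tsum_eq_sum (s := {0, 1}) fun x hx => ?_, Finset.sum_pair zero_ne_one]
    have : f x = 0 := by
      by_contra h0
      exact hx (by simpa using hf h0)
    rw [this, ENNReal.zero_rpow_of_pos hc0]
  rw [e]
  rcases le_total (f 1) (f 0) with h01 | h01
  · refine rpow_add_rpow_mul_lpSum_le hpq hc h01 (hf' 0) hg hh hg' hh' (fun x y => ?_)
      fun x y => ?_
    · simpa using hK 0 x y
    · refine (hK 1 x y).trans_eq (congrArg K ?_)
      ring
  -- reflecting `ℤ` exchanges the two points of the support of `f`
  · have key := rpow_add_rpow_mul_lpSum_le hpq hc (g := fun x => g (-x)) (h := fun x => h (-x))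
      (K := fun z => K (1 - z)) h01 (hf' 1) (hg.preimage neg_injective.injOn)
      (hh.preimage neg_injective.injOn) (fun x => hg' _) (fun x => hh' _)
      (fun x y => (hK 1 (-x) (-y)).trans_eq (congrArg K (by ring)))
      (fun x y => (hK 0 (-x) (-y)).trans_eq (congrArg K (by ring)))
    have e1 : ∀ (r : ℝ) (u : ℤ → ℝ≥0∞), lpSum r (fun x => u (-x)) = lpSum r u := fun r u => by
      rw [lpSum, lpSum, ← (Equiv.neg ℤ).tsum_eq fun x => u x ^ r]
      rfl
    have e2 : ∑' z, K (1 - z) = ∑' z, K z := (Equiv.subLeft (1 : ℤ)).tsum_eq K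
    rwa [e1, e1, e2, add_comm] at key

theorem lpSum_prod {E E' E₀ : Type*} {r : ℝ} (hr : 0 < r) (e : E × E' ≃ E₀) (f : E₀ → ℝ≥0∞) :
    lpSum r f = lpSum r fun s => lpSum r fun x => f (e (s, x)) := by
  change _ = (∑' s, (lpSum r fun x => f (e (s, x))) ^ r) ^ (1 / r)
  simp only [lpSum_rpow hr]
  rw [lpSum, ← e.tsum_eq, ENNReal.tsum_prod']

theorem lpSum_slice_support_finite {E E' E₀ : Type*} {r : ℝ} (hr : 0 < r) (e : E × E' ≃ E₀)
    {f : E₀ → ℝ≥0∞} (hf : f.support.Finite) :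
    (Function.support fun s => lpSum r fun x => f (e (s, x))).Finite := by
  refine (hf.image fun x => (e.symm x).1).subset fun s hs => ?_
  by_contra h0
  refine hs ?_
  have : (fun x => f (e (s, x))) = fun _ => 0 := by
    funext x
    by_contra hx
    exact h0 ⟨e (s, x), hx, by simp⟩
  simp only [this, lpSum_zero hr]

theorem support_slice_finite {E E' E₀ : Type*} (e : E × E' ≃ E₀)
    {f : E₀ → ℝ≥0∞} (hf : f.support.Finite) (s : E) :
    (Function.support fun x => f (e (s, x))).Finite :=
  hf.preimage (f := fun x => e (s, x)) fun x _ y _ hxy => by simpa using e.injective hxy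

/-- Tensorization. The group `E₀` is only identified with `E × E'`, so that it can be
`Fin (d + 1) → ℤ`. -/
theorem SupConvIneq.prod {p q c : ℝ} (hc : 0 < c) (hp : 0 < p) (hq : 0 < q) {E E' E₀ : Type*}
    [AddCommGroup E] [AddCommGroup E'] [AddCommGroup E₀] (e : E × E' ≃+ E₀) {C : Set E}
    {C' : Set E'} {C₀ : Set E₀} (hC : ∀ s x, e (s, x) ∈ C₀ → s ∈ C ∧ x ∈ C') (hfin : C₀.Finite)
    (h₁ : SupConvIneq c p q C) (h₂ : SupConvIneq c p q C') : SupConvIneq c p q C₀ := by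
  intro f g h K hf hg hh hf' hg' hh' hK
  have hf₀ : f.support.Finite := hfin.subset hf
  rw [lpSum_prod hc e.toEquiv f, lpSum_prod hp e.toEquiv g, lpSum_prod hq e.toEquiv h,
    ← e.toEquiv.tsum_eq, ENNReal.tsum_prod']
  refine h₁ _ _ _ _ ?_ (lpSum_slice_support_finite hp e.toEquiv hg)
    (lpSum_slice_support_finite hq e.toEquiv hh)
    (fun s => lpSum_ne_top hc (support_slice_finite e.toEquiv hf₀ s) fun x => hf' _)
    (fun s => lpSum_ne_top hp (support_slice_finite e.toEquiv hg s) fun x => hg' _)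
    (fun s => lpSum_ne_top hq (support_slice_finite e.toEquiv hh s) fun x => hh' _) ?_
  · intro s hs
    by_contra h0
    refine hs ?_
    have : (fun x => f (e.toEquiv (s, x))) = fun _ => 0 := by
      funext x
      by_contra hx
      exact h0 (hC s x (hf hx)).1
    simp only [this, lpSum_zero hc]
  · intro s t u
    refine h₂ _ _ _ _ (fun x hx => (hC s x (hf hx)).2) (support_slice_finite e.toEquiv hg t)
      (support_slice_finite e.toEquiv hh u) (fun x => hf' _) (fun x => hg' _) (fun x => hh' _) ?_
    intro x y z
    refine (hK _ _ _).trans_eq (congrArg K ?_)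
    change e (s, x) + e (t, y) + e (u, z) = e (s + t + u, x + y + z)
    rw [← map_add, ← map_add]
    rfl

theorem discreteCube_finite (d : ℕ) : (discreteCube d).Finite := by
  refine (Set.Finite.pi' fun _ : Fin d => Set.toFinite ({0, 1} : Set ℤ)).subset fun x hx i => ?_
  simpa using hx i

theorem supConvIneq_discreteCube {p q c : ℝ} (hpq : p.HolderConjugate q)
    (hc : (2 : ℝ) ^ (1 / c) = p ^ (1 / p) * q ^ (1 / q)) (d : ℕ) :
    SupConvIneq c p q (discreteCube d) := by
  have hc0 : 0 < c := one_pos.trans_le (one_le_exponent hpq hc)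
  induction d with
  | zero =>
    intro f g h K _ _ _ _ _ _ hK
    have e : ∀ {r : ℝ}, 0 < r → ∀ u : (Fin 0 → ℤ) → ℝ≥0∞, lpSum r u = u 0 := by
      intro r hr u
      rw [lpSum, tsum_eq_single 0 fun x hx => absurd (Subsingleton.elim x 0) hx,
        ← ENNReal.rpow_mul, mul_one_div_cancel hr.ne', ENNReal.rpow_one]
    rw [e hc0, e hpq.pos, e hpq.symm.pos,
      tsum_eq_single 0 fun x hx => absurd (Subsingleton.elim x 0) hx]
    simpa using hK 0 0 0
  | succ d ih =>
    let e : ℤ × (Fin d → ℤ) ≃+ (Fin (d + 1) → ℤ) :=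
      { Fin.consEquiv (fun _ : Fin (d + 1) => ℤ) with
        map_add' := fun x y => by
          funext i
          refine Fin.cases ?_ (fun j => ?_) i <;> rfl }
    refine SupConvIneq.prod hc0 hpq.pos hpq.symm.pos e (fun s x hx => ⟨?_, fun i => ?_⟩)
      (discreteCube_finite _) (supConvIneq_int hpq hc) ih
    · exact hx 0
    · exact hx i.succ

/-! ### Real-valued functions and finite sets -/

theorem ofReal_ellNorm {d : ℕ} {r : ℝ} (hr : 0 < r) {f : (Fin d → ℤ) → ℝ} (hf0 : ∀ x, 0 ≤ f x)
    (hf : f.support.Finite) :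
    ENNReal.ofReal (ellNorm r f) = lpSum r fun x => ENNReal.ofReal (f x) := by
  have hsum : Summable fun x => f x ^ r := summable_of_hasFiniteSupport (hf.subset fun x hx h0 =>
    hx (by simp [h0, Real.zero_rpow hr.ne']))
  have hnn : ∀ x, 0 ≤ f x ^ r := fun x => Real.rpow_nonneg (hf0 x) r
  simp only [ellNorm, lpSum, abs_of_nonneg (hf0 _), ENNReal.ofReal_rpow_of_nonneg (hf0 _) hr.le]
  rw [← ENNReal.ofReal_tsum_of_nonneg hnn hsum,
    ENNReal.ofReal_rpow_of_nonneg (tsum_nonneg hnn) (by positivity)]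

theorem ellNorm_nonneg {d : ℕ} (r : ℝ) (f : (Fin d → ℤ) → ℝ) : 0 ≤ ellNorm r f :=
  Real.rpow_nonneg (tsum_nonneg fun _ => Real.rpow_nonneg (abs_nonneg _) _) _

theorem supConv_nonneg {d : ℕ} {f g : (Fin d → ℤ) → ℝ} (hf : ∀ x, 0 ≤ f x) (hg : ∀ x, 0 ≤ g x)
    (z : Fin d → ℤ) : 0 ≤ supConv f g z :=
  Real.iSup_nonneg fun x => mul_nonneg (hf x) (hg _)

theorem mul_le_supConv {d : ℕ} {f : (Fin d → ℤ) → ℝ} (hf : f.support.Finite)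
    (g : (Fin d → ℤ) → ℝ) (x y : Fin d → ℤ) : f x * g y ≤ supConv f g (x + y) := by
  have hbdd : BddAbove (Set.range fun w => f w * g (x + y - w)) := by
    refine (((hf.image fun w => f w * g (x + y - w)).insert 0).subset ?_).bddAbove
    rintro _ ⟨w, rfl⟩
    by_cases hw : f w = 0
    · exact Or.inl (by simp [hw])
    · exact Or.inr ⟨w, hw, rfl⟩
  have := le_ciSup hbdd x
  rwa [add_sub_cancel_left] at this

theorem supConv_support_finite {d : ℕ} {f g : (Fin d → ℤ) → ℝ} (hf : f.support.Finite)
    (hg : g.support.Finite) : (supConv f g).support.Finite := by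
  refine (hf.add hg).subset fun z hz => ?_
  by_contra h0
  refine hz ?_
  have : ∀ x, f x * g (z - x) = 0 := by
    intro x
    by_contra hx
    exact h0 ⟨x, left_ne_zero_of_mul hx, z - x, right_ne_zero_of_mul hx, by simp⟩
  simp [supConv, this]

theorem ellNorm_mul_ellNorm_mul_ellNorm_le {p q c : ℝ} (hpq : p.HolderConjugate q)
    (hc : (2 : ℝ) ^ (1 / c) = p ^ (1 / p) * q ^ (1 / q)) {d : ℕ} {f g h : (Fin d → ℤ) → ℝ}
    (hf0 : ∀ x, 0 ≤ f x) (hg0 : ∀ x, 0 ≤ g x) (hh0 : ∀ x, 0 ≤ h x)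
    (hf : Function.support f ⊆ discreteCube d) (hg : g.support.Finite) (hh : h.support.Finite) :
    ellNorm c f * ellNorm p g * ellNorm q h ≤ ellNorm 1 (supConv (supConv f g) h) := by
  have hc0 : 0 < c := one_pos.trans_le (one_le_exponent hpq hc)
  have hff : f.support.Finite := (discreteCube_finite d).subset hf
  have hfg := supConv_support_finite hff hg
  have supp : ∀ u : (Fin d → ℤ) → ℝ,
      (Function.support fun x => ENNReal.ofReal (u x)) ⊆ u.support :=
    fun u x hx h0 => hx (by simp [h0])
  have key := supConvIneq_discreteCube hpq hc d (fun x => ENNReal.ofReal (f x))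
    (fun x => ENNReal.ofReal (g x)) (fun x => ENNReal.ofReal (h x))
    (fun x => ENNReal.ofReal (supConv (supConv f g) h x)) ((supp f).trans hf)
    (hg.subset (supp g)) (hh.subset (supp h)) (fun _ => ENNReal.ofReal_ne_top)
    (fun _ => ENNReal.ofReal_ne_top) (fun _ => ENNReal.ofReal_ne_top) (by
      intro x y z
      rw [← ENNReal.ofReal_mul (hf0 x), ← ENNReal.ofReal_mul (mul_nonneg (hf0 x) (hg0 y))]
      exact ENNReal.ofReal_le_ofReal ((mul_le_mul_of_nonneg_right (mul_le_supConv hff g x y)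
        (hh0 z)).trans (mul_le_supConv hfg h (x + y) z)))
  have h1 := ofReal_ellNorm one_pos (supConv_nonneg (supConv_nonneg hf0 hg0) hh0)
    (supConv_support_finite hfg hh)
  simp only [lpSum, ENNReal.rpow_one, div_one] at h1
  rw [← h1, ← ofReal_ellNorm hc0 hf0 hff, ← ofReal_ellNorm hpq.pos hg0 hg,
    ← ofReal_ellNorm hpq.symm.pos hh0 hh, ← ENNReal.ofReal_mul (ellNorm_nonneg _ _),
    ← ENNReal.ofReal_mul (mul_nonneg (ellNorm_nonneg _ _) (ellNorm_nonneg _ _))] at key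
  exact (ENNReal.ofReal_le_ofReal_iff (ellNorm_nonneg _ _)).1 key

theorem tsum_indicator_one {E : Type*} (V : Finset E) :
    ∑' x, (V : Set E).indicator (fun _ => (1 : ℝ≥0∞)) x = ENNReal.ofReal V.card := by
  rw [← tsum_subtype]
  simp

theorem lpSum_indicator_one {E : Type*} {r : ℝ} (hr : 0 < r) (V : Finset E) :
    lpSum r ((V : Set E).indicator fun _ => 1) = ENNReal.ofReal ((V.card : ℝ) ^ (1 / r)) := by
  have : ∀ x, ((V : Set E).indicator (fun _ => (1 : ℝ≥0∞)) x) ^ r =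
      (V : Set E).indicator (fun _ => (1 : ℝ≥0∞)) x := fun x => by
    by_cases hx : x ∈ (V : Set E) <;> simp [hx, hr]
  simp only [lpSum, this, tsum_indicator_one]
  exact ENNReal.ofReal_rpow_of_nonneg (Nat.cast_nonneg _) (by positivity)

theorem card_rpow_mul_le_card {p q c : ℝ} (hpq : p.HolderConjugate q)
    (hc : (2 : ℝ) ^ (1 / c) = p ^ (1 / p) * q ^ (1 / q)) {d : ℕ} {V A B S : Finset (Fin d → ℤ)}
    (hV : (V : Set (Fin d → ℤ)) ⊆ discreteCube d)
    (hS : ∀ x ∈ V, ∀ y ∈ A, ∀ z ∈ B, x + y + z ∈ S) :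
    (V.card : ℝ) ^ (1 / c) * (A.card : ℝ) ^ (1 / p) * (B.card : ℝ) ^ (1 / q) ≤ S.card := by
  have hc0 : 0 < c := one_pos.trans_le (one_le_exponent hpq hc)
  have top : ∀ (T : Finset (Fin d → ℤ)) x,
      (T : Set (Fin d → ℤ)).indicator (fun _ => (1 : ℝ≥0∞)) x ≠ ∞ := fun T x => by
    by_cases hx : x ∈ (T : Set (Fin d → ℤ)) <;> simp [hx]
  have key := supConvIneq_discreteCube hpq hc d ((V : Set _).indicator fun _ => 1)
    ((A : Set _).indicator fun _ => 1) ((B : Set _).indicator fun _ => 1)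
    ((S : Set _).indicator fun _ => 1) (Set.support_indicator_subset.trans hV)
    (A.finite_toSet.subset Set.support_indicator_subset)
    (B.finite_toSet.subset Set.support_indicator_subset) (top V) (top A) (top B) (by
      intro x y z
      by_cases hx : x ∈ V
      · by_cases hy : y ∈ A
        · by_cases hz : z ∈ B
          · simp [hx, hy, hz, hS x hx y hy z hz]
          · simp [hz]
        · simp [hy]
      · simp [hx])
  rw [lpSum_indicator_one hc0, lpSum_indicator_one hpq.pos, lpSum_indicator_one hpq.symm.pos,
    tsum_indicator_one, ← ENNReal.ofReal_mul (by positivity),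
    ← ENNReal.ofReal_mul (by positivity)] at key
  exact (ENNReal.ofReal_le_ofReal_iff (Nat.cast_nonneg _)).1 key

theorem card_le_two_pow {d : ℕ} {V : Finset (Fin d → ℤ)}
    (hV : (V : Set (Fin d → ℤ)) ⊆ discreteCube d) : V.card ≤ 2 ^ d := by
  have : V ⊆ Fintype.piFinset fun _ : Fin d => ({0, 1} : Finset ℤ) := fun x hx => by
    have : ∀ i, x i = 0 ∨ x i = 1 := hV hx
    simpa using this
  simpa using Finset.card_le_card this

theorem pow_mul_card_le_card_rpow {c : ℝ} (hc : 1 ≤ c) {d : ℕ} {V : Finset (Fin d → ℤ)}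
    (hV : (V : Set (Fin d → ℤ)) ⊆ discreteCube d) :
    ((2 : ℝ) ^ (1 / c) / 2) ^ d * V.card ≤ (V.card : ℝ) ^ (1 / c) := by
  have hc0 : 0 < c := by linarith
  rcases V.eq_empty_or_nonempty with rfl | hne
  · simp [hc0.ne']
  have hn : (0 : ℝ) < V.card := by exact_mod_cast hne.card_pos
  have hle : (V.card : ℝ) ≤ 2 ^ d := by exact_mod_cast card_le_two_pow hV
  have hexp : 0 ≤ 1 - 1 / c := sub_nonneg.2 ((div_le_one hc0).2 hc)
  have h1 : ((2 : ℝ) ^ (1 / c) / 2) ^ d = ((2 ^ d : ℝ) ^ (1 - 1 / c))⁻¹ := by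
    rw [Real.rpow_sub (by positivity), Real.rpow_one, inv_div, div_pow, ← Real.rpow_natCast,
      ← Real.rpow_mul two_pos.le, mul_comm (1 / c), Real.rpow_mul two_pos.le, Real.rpow_natCast]
  have h2 : (V.card : ℝ) = (V.card : ℝ) ^ (1 - 1 / c) * (V.card : ℝ) ^ (1 / c) := by
    rw [← Real.rpow_add hn, sub_add_cancel, Real.rpow_one]
  rw [h1, inv_mul_le_iff₀ (by positivity)]
  calc (V.card : ℝ) = (V.card : ℝ) ^ (1 - 1 / c) * (V.card : ℝ) ^ (1 / c) := h2
    _ ≤ _ := mul_le_mul_of_nonneg_right (Real.rpow_le_rpow hn.le hle hexp)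
      (Real.rpow_nonneg hn.le _)

theorem theorem1p3 (d : ℕ) (hd : 1 ≤ d) (p q c : ℝ) (hp : 1 < p) (hq : q = p / (p - 1))
    (hc : (2 : ℝ) ^ (1 / c) = p ^ (1 / p) * q ^ (1 / q)) :
    (∀ f g h : (Fin d → ℤ) → ℝ,
      (∀ x, 0 ≤ f x) → (∀ x, 0 ≤ g x) → (∀ x, 0 ≤ h x) →
      Function.support f ⊆ discreteCube d →
      (Function.support g).Finite → (Function.support h).Finite →
      ellNorm c f * ellNorm p g * ellNorm q h ≤ ellNorm 1 (supConv (supConv f g) h)) ∧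
    (∀ V A B : Finset (Fin d → ℤ), (V : Set (Fin d → ℤ)) ⊆ discreteCube d →
      (V.card : ℝ) ^ (1 / c) * (A.card : ℝ) ^ (1 / p) * (B.card : ℝ) ^ (1 / q)
          ≤ ((V + A + B).card : ℝ) ∧
      (p ^ (1 / p) * q ^ (1 / q) / 2) ^ d
            * (V.card : ℝ) * (A.card : ℝ) ^ (1 / p) * (B.card : ℝ) ^ (1 / q)
          ≤ (V.card : ℝ) ^ (1 / c) * (A.card : ℝ) ^ (1 / p) * (B.card : ℝ) ^ (1 / q)) := by
  have hpq : p.HolderConjugate q := (Real.holderConjugate_iff_eq_conjExponent hp).2 hq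
  refine ⟨fun f g h hf0 hg0 hh0 hf hg hh =>
    ellNorm_mul_ellNorm_mul_ellNorm_le hpq hc hf0 hg0 hh0 hf hg hh, fun V A B hV => ⟨?_, ?_⟩⟩
  · exact card_rpow_mul_le_card hpq hc hV fun x hx y hy z hz =>
      Finset.add_mem_add (Finset.add_mem_add hx hy) hz
  · rw [← hc]
    gcongr
    exact pow_mul_card_le_card_rpow (one_le_exponent hpq hc) hV
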